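/- All groups are finite. A \emph{functorial} is a function $\gamma$ assigning to each group $G$ a subgroup $\gamma(G)$ such that $f(\gamma(G))=\gamma(f(G))$ for every isomorphism $f:G\to G^*$ (in particular $\gamma(G)$ is a characteristic subgroup of $G$). A functorial $\gamma$ is called a \emph{hereditary Kurosh--Amitsur radical} if (P1) $f(\gamma(G))\subseteq\gamma(f(G))$ for every epimorphism $f:G\to G^*$; (P2) $\gamma(G)\cap N=\gamma(N)$ for every group $G$ and every $N\trianglelefteq G$; (P3) $\gamma(G/\gamma(G))=1$ for every group $G$. For functorials $\gamma_2,\gamma_1$ the \emph{upper product} $\gamma_2\star\gamma_1$ is the functorial defined by $(\gamma_2\star\gamma_1)(G)/\gamma_2(G)=\gamma_1(G/\gamma_2(G))$; this operation is associative. For a functorial $\gamma$ put $\gamma_{(0)}(G)=1$ and $\gamma_{(i+1)}=\gamma_{(i)}\star\gamma$; the \emph{$\gamma$-length} $h_\gamma(G)$ is the least $h\ge 0$ with $\gamma_{(h)}(G)=G$, and $h_\gamma(G)=\infty$ if there is no such $h$. Let $\mathrm{F}^*(G)$ denote the generalized Fitting subgroup of $G$, i.e. the subgroup generated by the Fitting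 subgroup of $G$ and all subnormal quasisimple subgroups of $G$. \textbf{Theorem.} Let $\rho$ be a hereditary Kurosh--Amitsur radical such that $\rho(G)$ contains the soluble radical (the largest normal soluble subgroup) of $G$ for every group $G$, and let $\gamma=\rho\star\mathrm{F}^*\star\rho$. If $M$ is a maximal subgroup of a group $G$ and $h_\gamma(G),h_\gamma(M)<\infty$, then $$h_\gamma(G)-h_\gamma(M)\leq 1.$$ -/

import Mathlib

universe u

namespace RadicalLength

section Subgroups

variable (G : Type u) [Group G]

/-- The soluble radical: the subgroup generated by all normal soluble subgroups
(for a finite group, the largest normal soluble subgroup). -/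
def solubleRadical : Subgroup G :=
  sSup {N : Subgroup G | N.Normal ∧ Group.IsSolvable N}

/-- The Fitting subgroup: the subgroup generated by all normal nilpotent subgroups
(for a finite group, the largest normal nilpotent subgroup). -/
def fitting : Subgroup G :=
  sSup {N : Subgroup G | N.Normal ∧ Group.IsNilpotent N}

/-- A group is quasisimple if it is perfect and its quotient by the centre is simple. -/
def IsQuasisimple : Prop :=
  Group.IsPerfect G ∧ IsSimpleGroup (G ⧸ Subgroup.center G)

/-- The layer: the subgroup generated by the components, i.e. the subnormal quasisimple
subgroups. -/
def layer : Subgroup G :=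
  sSup {K : Subgroup G | K.IsSubnormal ∧ IsQuasisimple K}

/-- The generalized Fitting subgroup, generated by the Fitting subgroup and the layer. -/
def generalizedFitting : Subgroup G :=
  fitting G ⊔ layer G

end Subgroups

section Transport

variable {G H : Type u} [Group G] [Group H]

theorem IsQuasisimple.of_mulEquiv (e : G ≃* H) (h : IsQuasisimple G) : IsQuasisimple H := by
  obtain ⟨h1, h2⟩ := h
  have hc : (Subgroup.center G).map (e : G →* H) = Subgroup.center H := by
    ext x
    simp only [Subgroup.mem_map, Subgroup.mem_center_iff]
    constructor
    · rintro ⟨y, hy, rfl⟩ g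
      obtain ⟨g, rfl⟩ := e.surjective g
      simpa using congrArg e (hy g)
    · intro hx
      refine ⟨e.symm x, fun g => e.injective ?_, by simp⟩
      simpa using hx (e g)
  exact ⟨Group.IsPerfect.ofSurjective (f := (e : G →* H)) e.surjective,
    ((QuotientGroup.congr _ _ e hc).isSimpleGroup_congr).1 h2⟩

theorem fitting_map_le (e : G ≃* H) : (fitting G).map (e : G →* H) ≤ fitting H := by
  rw [fitting, Subgroup.map_le_iff_le_comap]
  refine sSup_le ?_
  rintro N ⟨hN, hnil⟩
  rw [← Subgroup.map_le_iff_le_comap]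
  exact le_sSup ⟨hN.map _ e.surjective,
    (Group.isNilpotent_congr (e.subgroupMap N)).1 hnil⟩

theorem layer_map_le (e : G ≃* H) : (layer G).map (e : G →* H) ≤ layer H := by
  rw [layer, Subgroup.map_le_iff_le_comap]
  refine sSup_le ?_
  rintro K ⟨hK, hq⟩
  rw [← Subgroup.map_le_iff_le_comap]
  exact le_sSup ⟨hK.map e.surjective, hq.of_mulEquiv (e.subgroupMap K)⟩

theorem generalizedFitting_map_le (e : G ≃* H) :
    (generalizedFitting G).map (e : G →* H) ≤ generalizedFitting H := by
  rw [generalizedFitting, Subgroup.map_sup]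
  exact sup_le_sup (fitting_map_le e) (layer_map_le e)

end Transport

/-- A functorial: a function assigning to each finite group `G` a subgroup of `G`, compatible
with all isomorphisms of finite groups. -/
structure Functorial where
  sub : ∀ (G : Type u) [Group G] [Finite G], Subgroup G
  map_sub : ∀ (G H : Type u) [Group G] [Finite G] [Group H] [Finite H] (e : G ≃* H),
    (sub G).map (e : G →* H) = sub H

namespace Functorial

instance characteristic_sub (γ : Functorial.{u}) (G : Type u) [Group G] [Finite G] :
    (γ.sub G).Characteristic :=
  Subgroup.characteristic_iff_map_eq.2 fun e => γ.map_sub G G e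

/-- A family of subgroups that every isomorphism maps into the corresponding one is
a functorial. -/
def ofMapLE (s : ∀ (G : Type u) [Group G] [Finite G], Subgroup G)
    (hs : ∀ (G H : Type u) [Group G] [Finite G] [Group H] [Finite H] (e : G ≃* H),
      (s G).map (e : G →* H) ≤ s H) : Functorial.{u} where
  sub := s
  map_sub G H _ _ _ _ e := by
    refine le_antisymm (hs G H e) fun x hx => ?_
    exact ⟨e.symm x, hs H G e.symm ⟨x, hx, rfl⟩, by simp⟩

/-- The functorial `F*` sending a finite group to its generalized Fitting subgroup. -/
def generalizedFitting : Functorial.{u} :=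
  ofMapLE (fun G _ _ => RadicalLength.generalizedFitting G)
    fun _ _ _ _ _ _ e => generalizedFitting_map_le e

/-- The functorial sending every finite group to its trivial subgroup. -/
def trivial : Functorial.{u} :=
  ofMapLE (fun _ _ _ => ⊥) fun _ _ _ _ _ _ _ => by simp

/-- The upper product `γ₂ ⋆ γ₁`, given by `(γ₂ ⋆ γ₁)(G) / γ₂(G) = γ₁(G / γ₂(G))`. -/
def star (γ₂ γ₁ : Functorial.{u}) : Functorial.{u} :=
  ofMapLE (fun G _ _ => (γ₁.sub (G ⧸ γ₂.sub G)).comap (QuotientGroup.mk' (γ₂.sub G))) (by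
    intro G H _ _ _ _ e
    rw [Subgroup.map_le_iff_le_comap]
    intro x hx
    have h := γ₁.map_sub _ _ (QuotientGroup.congr _ _ e (γ₂.map_sub G H e))
    rw [Subgroup.mem_comap, Subgroup.mem_comap, ← h]
    exact ⟨_, hx, rfl⟩)

/-- The terms `γ₍ₙ₎` of the `γ`-series: `γ₍₀₎ = 1` and `γ₍ₙ₊₁₎ = γ₍ₙ₎ ⋆ γ`. -/
def series (γ : Functorial.{u}) : ℕ → Functorial.{u}
  | 0 => trivial
  | n + 1 => (γ.series n).star γ

/-- The `γ`-length of `G`: the least `n` with `γ₍ₙ₎(G) = G`, and `∞` if there is none. -/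
noncomputable def length (γ : Functorial.{u}) (G : Type u) [Group G] [Finite G] : ℕ∞ :=
  sInf {h : ℕ∞ | ∃ n : ℕ, h = n ∧ (γ.series n).sub G = ⊤}

/-- Hereditary Plotkin radicals: `f(γ(G)) ⊆ γ(f(G))` for every epimorphism `f`, and
`γ(G) ∩ N = γ(N)` for every normal subgroup `N` of `G`. -/
structure IsHereditaryPlotkinRadical (γ : Functorial.{u}) : Prop where
  map_le : ∀ (G H : Type u) [Group G] [Finite G] [Group H] [Finite H] (f : G →* H),
    Function.Surjective f → (γ.sub G).map f ≤ γ.sub H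
  inf_normal : ∀ (G : Type u) [Group G] [Finite G] (N : Subgroup G), N.Normal →
    γ.sub G ⊓ N = (γ.sub N).map N.subtype

/-- Hereditary Kurosh–Amitsur radicals: hereditary Plotkin radicals `γ` such that
`γ(G / γ(G))` is always trivial. -/
structure IsHereditaryKuroshAmitsurRadical (γ : Functorial.{u}) : Prop
    extends IsHereditaryPlotkinRadical γ where
  sub_quotient : ∀ (G : Type u) [Group G] [Finite G], γ.sub (G ⧸ γ.sub G) = ⊥

end Functorial

end RadicalLength

/-! Put `σ = ρ ⋆ F*`. Since `ρ ⋆ ρ = ρ`, also `ρ ⋆ σ = σ`, so for `n ≥ 1` the `n`-th term of the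
`γ`-series is `σ ⋆ (… ⋆ (σ ⋆ ρ))` with `n` factors `σ`, which is `layers σ ρ n`. It suffices that
`n` layers exhausting `M` force `n + 1` layers to exhaust `G` (`layers_succ_sub_eq_top`). If `σ(G) ≰
M`, then `M σ(G) = G`, so `G / σ(G)` is a quotient of `M` and is exhausted by `n` layers. If `σ(G) ≤
M`, then `σ(M) = σ(G)` (`star_generalizedFitting_sub_eq_subgroupOf`), and induction applies to the
maximal subgroup `M / σ(G)` of `G / σ(G)`. The equality `σ(M) = σ(G)` rests on `F*` having trivial
centralizer when the radical is trivial (`centralizer_generalizedFitting_eq_bot`). -/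

namespace RadicalLength

open Subgroup

/-! ### Quasisimple groups, components and the Fitting subgroup. -/

section Components

variable {G H : Type u} [Group G] [Group H]

/-- If `N` is not central, it covers the simple quotient `G / Z(G)`; then `G = N Z(G)`, so `G / N`
is both abelian and perfect, hence trivial. -/
theorem IsQuasisimple.eq_top_or_le_center (h : IsQuasisimple G) (N : Subgroup G) [N.Normal] :
    N = ⊤ ∨ N ≤ center G := by
  obtain ⟨hp, hs⟩ := h
  have hN : (N.map (QuotientGroup.mk' (center G))).Normal :=
    Normal.map inferInstance _ (QuotientGroup.mk'_surjective _)
  rcases hN.eq_bot_or_eq_top with h | h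
  · right
    rwa [Subgroup.map_eq_bot_iff, QuotientGroup.ker_mk'] at h
  · left
    have hsup : N ⊔ center G = ⊤ := by
      have := congrArg (Subgroup.comap (QuotientGroup.mk' (center G))) h
      rwa [Subgroup.comap_map_eq, QuotientGroup.ker_mk', Subgroup.comap_top] at this
    have hcomm : ∀ a b : G ⧸ N, a * b = b * a := by
      intro a b
      obtain ⟨x, rfl⟩ := QuotientGroup.mk'_surjective N a
      obtain ⟨y, rfl⟩ := QuotientGroup.mk'_surjective N b
      obtain ⟨n, hn, z, hz, rfl⟩ := Subgroup.mem_sup_of_normal_left.1 (show x ∈ N ⊔ center G from hsup ▸ Subgroup.mem_top x)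
      have hn1 : QuotientGroup.mk' N n = 1 := (QuotientGroup.eq_one_iff n).2 hn
      rw [map_mul, hn1, one_mul, ← map_mul, ← map_mul, (Subgroup.mem_center_iff.1 hz y)]
    have : IsMulCommutative (G ⧸ N) := ⟨⟨hcomm⟩⟩
    have : Subsingleton (G ⧸ N) := Group.IsPerfect.subsingleton_of_isMulCommutative
    exact QuotientGroup.subgroup_eq_top_of_subsingleton N this

theorem IsQuasisimple.nontrivial (h : IsQuasisimple G) : Nontrivial G := by
  have := h.2.toNontrivial
  exact (QuotientGroup.mk'_surjective (center G)).nontrivial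

theorem IsQuasisimple.of_surjective (h : IsQuasisimple G) (f : G →* H)
    (hf : Function.Surjective f) [Nontrivial H] : IsQuasisimple H := by
  have := h.1
  have hp : Group.IsPerfect H := Group.IsPerfect.ofSurjective hf
  refine ⟨hp, ?_⟩
  have hnt : Nontrivial (H ⧸ center H) := by
    rw [QuotientGroup.nontrivial_iff]
    intro hc
    exact Group.IsPerfect.not_isMulCommutative (G := H) (Subgroup.center_eq_top_iff.1 hc)
  refine { exists_pair_ne := hnt.exists_pair_ne, eq_bot_or_eq_top_of_normal := fun N hN => ?_ }
  have hq : Function.Surjective ((QuotientGroup.mk' (center H)).comp f) :=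
    (QuotientGroup.mk'_surjective _).comp hf
  rcases h.eq_top_or_le_center (N.comap ((QuotientGroup.mk' (center H)).comp f)) with h1 | h1
  · right
    rw [← Subgroup.map_comap_eq_self_of_surjective hq N, h1, ← MonoidHom.range_eq_map,
      MonoidHom.range_eq_top.2 hq]
  · left
    rw [← Subgroup.map_comap_eq_self_of_surjective hq N, eq_bot_iff, Subgroup.map_le_iff_le_comap]
    intro x hx
    have hxc := Subgroup.mem_center_iff.1 (h1 hx)
    refine (QuotientGroup.eq_one_iff (f x)).2 (Subgroup.mem_center_iff.2 fun y => ?_)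
    obtain ⟨y, rfl⟩ := hf y
    rw [← map_mul, hxc, map_mul]

theorem isQuasisimple_of_isSimpleGroup (hG : IsSimpleGroup G) (h : ¬ IsMulCommutative G) :
    IsQuasisimple G := by
  constructor
  · rcases (inferInstance : (commutator G).Normal).eq_bot_or_eq_top with h1 | h1
    · exact absurd ((commutator_eq_bot_iff G).1 h1) h
    · exact ⟨h1⟩
  · rcases (inferInstance : (center G).Normal).eq_bot_or_eq_top with h1 | h1
    · exact ((QuotientGroup.quotientMulEquivOfEq h1).trans
        QuotientGroup.quotientBot).isSimpleGroup_congr.2 hG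
    · exact absurd (Subgroup.center_eq_top_iff.1 h1) h

theorem fitting_map_le_of_surjective (f : G →* H) (hf : Function.Surjective f) :
    (fitting G).map f ≤ fitting H := by
  rw [fitting, Subgroup.map_le_iff_le_comap]
  refine sSup_le ?_
  rintro N ⟨hN, hnil⟩
  rw [← Subgroup.map_le_iff_le_comap]
  exact le_sSup ⟨hN.map _ hf, Group.nilpotent_of_surjective _ (f.subgroupMap_surjective N)⟩

theorem le_layer {K : Subgroup G} (hK : K.IsSubnormal) (hq : IsQuasisimple K) : K ≤ layer G :=
  le_sSup ⟨hK, hq⟩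

theorem layer_map_le_of_surjective (f : G →* H) (hf : Function.Surjective f) :
    (layer G).map f ≤ layer H := by
  rw [layer, Subgroup.map_le_iff_le_comap]
  refine sSup_le ?_
  rintro K ⟨hK, hq⟩
  rw [← Subgroup.map_le_iff_le_comap]
  rcases eq_or_ne (K.map f) ⊥ with h | h
  · rw [h]; exact bot_le
  · have := (Subgroup.nontrivial_iff_ne_bot _).2 h
    exact le_sSup ⟨hK.map hf, hq.of_surjective _ (f.subgroupMap_surjective K)⟩

theorem generalizedFitting_map_le_of_surjective (f : G →* H) (hf : Function.Surjective f) :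
    (generalizedFitting G).map f ≤ generalizedFitting H := by
  rw [generalizedFitting, Subgroup.map_sup]
  exact sup_le_sup (fitting_map_le_of_surjective f hf) (layer_map_le_of_surjective f hf)

/-- If a normal subgroup `F` meets a subnormal subgroup `A` in a subgroup centralizing the perfect
subgroup `K ≤ A`, then `F` centralizes `K`. -/
theorem commutator_eq_bot_of_isSubnormal {F A : Subgroup G} [F.Normal] (hA : A.IsSubnormal)
    {K : Subgroup G} (hK : Group.IsPerfect K) (hKA : K ≤ A) (h : ⁅F ⊓ A, K⁆ = ⊥) :
    ⁅F, K⁆ = ⊥ := by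
  induction hA with
  | top => simpa using h
  | step A B hAB _ hN ih =>
    refine ih (hKA.trans hAB) ?_
    have h1 : ⁅F ⊓ B, K⁆ ≤ F ⊓ A := by
      rw [Subgroup.commutator_le]
      intro x hx y hy
      refine ⟨?_, ?_⟩
      · have hc := (inferInstance : F.Normal).conj_mem x⁻¹ (F.inv_mem hx.1) y
        have := F.mul_mem hx.1 hc
        simpa [commutatorElement_def, mul_assoc] using this
      · have hc := hN.conj_mem ⟨y, hAB (hKA hy)⟩ (hKA hy : _) ⟨x, hx.2⟩
        have hc' : x * y * x⁻¹ ∈ A := hc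
        exact A.mul_mem hc' (A.inv_mem (hKA hy))
    have h2 : ⁅⁅F ⊓ B, K⁆, K⁆ = ⊥ := le_bot_iff.1 ((Subgroup.commutator_mono h1 le_rfl).trans h.le)
    have h3 : ⁅⁅K, F ⊓ B⁆, K⁆ = ⊥ := by rwa [Subgroup.commutator_comm K]
    -- Three subgroups lemma: `⁅⁅K, K⁆, F ⊓ B⁆ = ⊥`, and `K = ⁅K, K⁆`.
    have h4 := Subgroup.commutator_commutator_eq_bot_of_rotate h3 h2
    rwa [Subgroup.isPerfect_iff.1 hK, Subgroup.commutator_comm] at h4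

/-- A component is contained in a given normal subgroup or centralizes it. -/
theorem le_or_le_centralizer_of_isQuasisimple {F K : Subgroup G} [F.Normal] (hK : K.IsSubnormal)
    (hq : IsQuasisimple K) : K ≤ F ∨ K ≤ centralizer F := by
  rcases hq.eq_top_or_le_center (F.subgroupOf K) with h | h
  · exact Or.inl (Subgroup.subgroupOf_eq_top.1 h)
  · right
    rw [← Subgroup.commutator_eq_bot_iff_le_centralizer, Subgroup.commutator_comm]
    refine commutator_eq_bot_of_isSubnormal hK hq.1 le_rfl ?_
    rw [Subgroup.commutator_eq_bot_iff_le_centralizer]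
    intro x hx
    rw [Subgroup.mem_centralizer_iff]
    intro y hy
    have := Subgroup.mem_center_iff.1
      (h (show (⟨x, hx.2⟩ : K) ∈ F.subgroupOf K from hx.1)) ⟨y, hy⟩
    exact congrArg Subtype.val this

theorem fitting_le_solubleRadical : fitting G ≤ solubleRadical G := by
  refine sSup_le ?_
  rintro N ⟨hN, hnil⟩
  exact le_sSup ⟨hN, inferInstance⟩

theorem solubleRadical_eq_top [hG : Group.IsSolvable G] : solubleRadical G = ⊤ :=
  top_le_iff.1 (le_sSup ⟨inferInstance, inferInstance⟩)

/-- In a finite group every nontrivial normal subgroup contains a simple subnormal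
subgroup. -/
theorem exists_isSubnormal_isSimpleGroup_le [Finite G] {C : Subgroup G} [hC : C.Normal]
    (h : C ≠ ⊥) : ∃ T : Subgroup G, T.IsSubnormal ∧ T ≤ C ∧ IsSimpleGroup T := by
  -- A minimal nontrivial subnormal subgroup inside `C` is simple, because its normal subgroups are
  -- again subnormal in `G`.
  obtain ⟨T, hT⟩ := (Set.toFinite {T : Subgroup G | T.IsSubnormal ∧ T ≤ C ∧ T ≠ ⊥}).exists_minimal
    ⟨C, hC.isSubnormal, le_rfl, h⟩
  obtain ⟨⟨hs, hTC, hne⟩, hmin⟩ := hT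
  refine ⟨T, hs, hTC, ?_⟩
  have := (Subgroup.nontrivial_iff_ne_bot T).2 hne
  refine { exists_pair_ne := this.exists_pair_ne, eq_bot_or_eq_top_of_normal := fun N hN => ?_ }
  rcases eq_or_ne N ⊥ with h1 | h1
  · exact Or.inl h1
  · right
    have hle : N.map T.subtype ≤ T := Subgroup.map_subtype_le N
    have := hmin (y := N.map T.subtype) ⟨hN.isSubnormal.trans' hs, hle.trans hTC,
      fun h0 => h1 ((Subgroup.map_eq_bot_iff_of_injective _ T.subtype_injective).1 h0)⟩ hle
    refine (Subgroup.eq_top_iff' _).2 fun x => ?_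
    obtain ⟨y, hy, hyx⟩ := this x.2
    rwa [← show y = x from Subtype.ext hyx]

end Components

namespace Functorial

/-! ### Groups with trivial radical. -/

section Radical

variable {ρ : Functorial.{u}}

theorem IsHereditaryPlotkinRadical.inf_isSubnormal (hρ : ρ.IsHereditaryPlotkinRadical)
    {G : Type u} [Group G] [Finite G] {N : Subgroup G} (hN : N.IsSubnormal) :
    ρ.sub G ⊓ N = (ρ.sub N).map N.subtype := by
  induction hN with
  | top =>
    rw [hρ.inf_normal G ⊤ inferInstance]
  | step A B hAB _ hn ih =>
    have h1 := congrArg (Subgroup.map B.subtype) (hρ.inf_normal B _ hn)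
    have h2 := ρ.map_sub _ _ (Subgroup.subgroupOfEquivOfLe hAB)
    rw [Subgroup.map_inf_eq _ _ _ B.subtype_injective, ← ih, Subgroup.map_subgroupOf_eq_of_le hAB,
      inf_assoc, inf_eq_right.2 hAB, Subgroup.map_map] at h1
    rw [h1, ← h2, Subgroup.map_map]
    rfl

theorem sub_eq_top_of_isSolvable
    (hsol : ∀ (G : Type u) [Group G] [Finite G], solubleRadical G ≤ ρ.sub G)
    (G : Type u) [Group G] [Finite G] [Group.IsSolvable G] : ρ.sub G = ⊤ :=
  top_le_iff.1 (solubleRadical_eq_top.symm.le.trans (hsol G))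


/-- In a group with trivial radical the generalized Fitting subgroup has trivial centralizer. -/
theorem centralizer_generalizedFitting_eq_bot
    (hρ : ρ.IsHereditaryKuroshAmitsurRadical)
    (hsol : ∀ (G : Type u) [Group G] [Finite G], solubleRadical G ≤ ρ.sub G)
    {G : Type u} [Group G] [Finite G]
    (hG : ρ.sub G = ⊥) :
    centralizer (generalizedFitting.sub G : Set G) = ⊥ := by
  by_contra hC
  obtain ⟨T, hT, hTC, hs⟩ := exists_isSubnormal_isSimpleGroup_le hC
  -- A nonabelian `T` would be a component, hence lie in `F*` and centralize itself. An abelian `T`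
  -- is its own radical, against `ρ(G) = 1`.
  have hcomm : IsMulCommutative T := by
    by_contra hnc
    have hTF : T ≤ generalizedFitting.sub G :=
      (le_layer hT (isQuasisimple_of_isSimpleGroup hs hnc)).trans
        (le_sup_right : layer G ≤ RadicalLength.generalizedFitting G)
    exact hnc ⟨⟨fun a b => Subtype.ext (Subgroup.mem_centralizer_iff.1 (hTC b.2) a (hTF a.2))⟩⟩
  have hsolT : Group.IsSolvable T := Group.isSolvable_of_comm fun a b => hcomm.is_comm.comm a b
  have h1 := hρ.inf_isSubnormal hT
  rw [hG, bot_inf_eq, sub_eq_top_of_isSolvable hsol T, ← MonoidHom.range_eq_map,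
    Subgroup.range_subtype] at h1
  exact (Subgroup.nontrivial_iff_ne_bot T).1 hs.toNontrivial h1.symm

/-- By heredity `ρ(M) ∩ F* = ρ(F*) = 1`; two normal subgroups of `M` meeting trivially commute, so
`ρ(M)` lies in the trivial centralizer of `F*`. -/
theorem sub_eq_bot_of_generalizedFitting_le
    (hρ : ρ.IsHereditaryKuroshAmitsurRadical)
    (hsol : ∀ (G : Type u) [Group G] [Finite G], solubleRadical G ≤ ρ.sub G)
    {G : Type u} [Group G] [Finite G]
    (hG : ρ.sub G = ⊥) {M : Subgroup G}
    (hM : generalizedFitting.sub G ≤ M) : ρ.sub M = ⊥ := by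
  set F := generalizedFitting.sub G
  have hFn : F.Normal := inferInstance
  have hρF : ρ.sub F = ⊥ := by
    have := hρ.inf_normal G F inferInstance
    rw [hG, bot_inf_eq] at this
    exact (Subgroup.map_eq_bot_iff_of_injective _ F.subtype_injective).1 this.symm
  have hρF' : ρ.sub (F.subgroupOf M) = ⊥ := by
    rw [← ρ.map_sub _ _ (Subgroup.subgroupOfEquivOfLe hM).symm, hρF, Subgroup.map_bot]
  have hdis : Disjoint (ρ.sub M) (F.subgroupOf M) := by
    rw [disjoint_iff, hρ.inf_normal M _ inferInstance, hρF', Subgroup.map_bot]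
  have hle : (ρ.sub M).map M.subtype ≤ centralizer F := by
    rintro _ ⟨x, hx, rfl⟩
    rw [Subgroup.mem_centralizer_iff]
    intro y hy
    have := Subgroup.commute_of_normal_of_disjoint _ _ inferInstance inferInstance hdis x
      ⟨y, hM hy⟩ hx hy
    exact congrArg Subtype.val this.symm.eq
  rw [centralizer_generalizedFitting_eq_bot hρ hsol hG, le_bot_iff] at hle
  exact (Subgroup.map_eq_bot_iff_of_injective _ M.subtype_injective).1 hle

/-- With trivial radicals `F*` is just the layer. A component of `M` outside `F*(G)` would
centralize it, which is impossible; conversely, components of `G` lie in `M` and stay subnormal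
there. -/
theorem generalizedFitting_map_subtype_eq
    (hρ : ρ.IsHereditaryKuroshAmitsurRadical)
    (hsol : ∀ (G : Type u) [Group G] [Finite G], solubleRadical G ≤ ρ.sub G)
    {G : Type u} [Group G] [Finite G]
    (hG : ρ.sub G = ⊥) {M : Subgroup G}
    (hM : generalizedFitting.sub G ≤ M) :
    (generalizedFitting.sub M).map M.subtype = generalizedFitting.sub G := by
  have hFit : ∀ (H : Type u) [Group H] [Finite H], ρ.sub H = ⊥ →
      generalizedFitting.sub H = layer H := by
    intro H _ _ hH
    have : fitting H = ⊥ :=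
      le_bot_iff.1 (fitting_le_solubleRadical.trans ((hsol H).trans hH.le))
    change fitting H ⊔ layer H = _
    rw [this, bot_sup_eq]
  have hFn : (generalizedFitting.sub G).Normal := inferInstance
  have hC := centralizer_generalizedFitting_eq_bot hρ hsol hG
  rw [hFit M (sub_eq_bot_of_generalizedFitting_le hρ hsol hG hM)]
  apply le_antisymm
  · rw [Subgroup.map_le_iff_le_comap]
    refine sSup_le ?_
    rintro K ⟨hK, hq⟩
    rcases le_or_le_centralizer_of_isQuasisimple (F := (generalizedFitting.sub G).subgroupOf M)
      hK hq with h | h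
    · exact h
    · have hle : K.map M.subtype ≤ centralizer (generalizedFitting.sub G : Set G) := by
        rintro _ ⟨x, hx, rfl⟩
        rw [Subgroup.mem_centralizer_iff]
        intro y hy
        exact congrArg Subtype.val (Subgroup.mem_centralizer_iff.1 (h hx) ⟨y, hM hy⟩ hy)
      rw [hC, le_bot_iff, Subgroup.map_eq_bot_iff_of_injective _ M.subtype_injective] at hle
      exact absurd hle ((Subgroup.nontrivial_iff_ne_bot K).1 hq.nontrivial)
  · rw [hFit G hG] at hM ⊢
    refine sSup_le ?_
    rintro K ⟨hK, hq⟩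
    have hKM : K ≤ M := (le_layer hK hq).trans hM
    rw [← Subgroup.map_subgroupOf_eq_of_le hKM]
    exact Subgroup.map_mono (le_sSup ⟨hK.subgroupOf,
      hq.of_mulEquiv (Subgroup.subgroupOfEquivOfLe hKM).symm⟩)

end Radical

/-! ### Algebra of the upper product. -/

section Star

theorem ext_sub {α β : Functorial.{u}}
    (h : ∀ (G : Type u) [Group G] [Finite G], α.sub G = β.sub G) : α = β := by
  cases α; cases β
  congr
  funext G _ _
  exact h G

/-- Every epimorphism `f : G → H` maps `α(G)` into `α(H)`. -/
def MapLE (α : Functorial.{u}) : Prop :=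
  ∀ (G H : Type u) [Group G] [Finite G] [Group H] [Finite H] (f : G →* H),
    Function.Surjective f → (α.sub G).map f ≤ α.sub H

theorem mapLE_generalizedFitting : MapLE generalizedFitting.{u} :=
  fun _ _ _ _ _ _ f hf => generalizedFitting_map_le_of_surjective f hf

/-- The upper product can be computed in any quotient by `α(G)`. -/
theorem star_sub_eq_comap (α β : Functorial.{u}) {G H : Type u} [Group G] [Finite G] [Group H]
    [Finite H] (f : G →* H) (hf : Function.Surjective f) (hk : f.ker = α.sub G) :
    (α.star β).sub G = (β.sub H).comap f := by
  let e : G ⧸ α.sub G ≃* H :=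
    (QuotientGroup.quotientMulEquivOfEq hk.symm).trans
      (QuotientGroup.quotientKerEquivOfSurjective f hf)
  have he : ∀ x : G, e (QuotientGroup.mk' _ x) = f x := fun x => rfl
  rw [← β.map_sub _ _ e]
  ext x
  rw [Subgroup.mem_comap, ← he]
  have hinj : Function.Injective (e : G ⧸ α.sub G →* H) := e.injective
  exact (Subgroup.mem_map_iff_mem hinj).symm

theorem star_sub (α β : Functorial.{u}) (G : Type u) [Group G] [Finite G] :
    (α.star β).sub G = (β.sub (G ⧸ α.sub G)).comap (QuotientGroup.mk' (α.sub G)) := rfl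

theorem star_assoc (α β δ : Functorial.{u}) : (α.star β).star δ = α.star (β.star δ) := by
  refine ext_sub fun G _ _ => ?_
  rw [star_sub_eq_comap (α.star β) δ
    ((QuotientGroup.mk' (β.sub (G ⧸ α.sub G))).comp (QuotientGroup.mk' (α.sub G)))
    ((QuotientGroup.mk'_surjective _).comp (QuotientGroup.mk'_surjective _))
    (by rw [← MonoidHom.comap_ker, QuotientGroup.ker_mk', star_sub]), ← Subgroup.comap_comap]
  rfl

theorem trivial_star (α : Functorial.{u}) : trivial.star α = α := by
  refine ext_sub fun G _ _ => ?_
  rw [star_sub_eq_comap trivial α (MonoidHom.id G) Function.surjective_id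
    ((MonoidHom.ker_eq_bot_iff _).2 Function.injective_id), Subgroup.comap_id]

theorem star_self {ρ : Functorial.{u}} (hρ : ρ.IsHereditaryKuroshAmitsurRadical) :
    ρ.star ρ = ρ := by
  refine ext_sub fun G _ _ => ?_
  rw [star_sub, hρ.sub_quotient, MonoidHom.comap_bot, QuotientGroup.ker_mk']

theorem MapLE.star {α β : Functorial.{u}} (hα : α.MapLE) (hβ : β.MapLE) : (α.star β).MapLE := by
  intro G H _ _ _ _ f hf
  rw [Subgroup.map_le_iff_le_comap]
  intro x hx
  let g : G ⧸ α.sub G →* H ⧸ α.sub H :=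
    QuotientGroup.map _ _ f (Subgroup.map_le_iff_le_comap.1 (hα G H f hf))
  have hg : Function.Surjective g := by
    intro y
    obtain ⟨y, rfl⟩ := QuotientGroup.mk'_surjective _ y
    obtain ⟨z, rfl⟩ := hf y
    exact ⟨QuotientGroup.mk' _ z, rfl⟩
  exact hβ _ _ g hg ⟨_, hx, rfl⟩

theorem MapLE.sub_eq_top {α : Functorial.{u}} (hα : α.MapLE) {G H : Type u} [Group G] [Finite G]
    [Group H] [Finite H] (f : G →* H) (hf : Function.Surjective f) (h : α.sub G = ⊤) :
    α.sub H = ⊤ := by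
  have := hα G H f hf
  rwa [h, ← MonoidHom.range_eq_map, MonoidHom.range_eq_top.2 hf, top_le_iff] at this

theorem star_sub_eq_top_iff (α β : Functorial.{u}) {G H : Type u} [Group G] [Finite G] [Group H]
    [Finite H] (f : G →* H) (hf : Function.Surjective f) (hk : f.ker = α.sub G) :
    (α.star β).sub G = ⊤ ↔ β.sub H = ⊤ := by
  rw [star_sub_eq_comap α β f hf hk, ← Subgroup.comap_top f,
    (Subgroup.comap_injective hf).eq_iff]

end Star

/-! ### The layers of `G` and of a maximal subgroup. -/

section Layers

/-- The functorials `ρ`, `σ ⋆ ρ`, `σ ⋆ (σ ⋆ ρ)`, …. -/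
def layers (σ ρ : Functorial.{u}) : ℕ → Functorial.{u}
  | 0 => ρ
  | n + 1 => σ.star (layers σ ρ n)

theorem MapLE.layers {σ ρ : Functorial.{u}} (hσ : σ.MapLE) (hρ : ρ.MapLE) :
    ∀ n, (layers σ ρ n).MapLE
  | 0 => hρ
  | n + 1 => hσ.star (MapLE.layers hσ hρ n)

theorem layers_star {σ ρ : Functorial.{u}} (h : ρ.star σ = σ) (n : ℕ) :
    (layers σ ρ n).star (σ.star ρ) = layers σ ρ (n + 1) := by
  induction n with
  | zero => rw [layers, ← star_assoc, h]; rfl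
  | succ n ih => rw [layers, star_assoc, ih]; rfl

theorem series_succ_eq_layers {σ ρ : Functorial.{u}} (h : ρ.star σ = σ) (n : ℕ) :
    (σ.star ρ).series (n + 1) = layers σ ρ (n + 1) := by
  induction n with
  | zero => exact trivial_star _
  | succ n ih => rw [series, ih, layers_star h]

variable {ρ : Functorial.{u}}

/-- The image of `ρ(M)` in `M / ρ(G)` is radical, hence trivial; conversely, `ρ(G)` is its own
radical and normal in `M`, so heredity puts it in `ρ(M)`. -/
theorem sub_eq_subgroupOf (hρ : ρ.IsHereditaryKuroshAmitsurRadical)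
    {G : Type u} [Group G] [Finite G] {M : Subgroup G}
    (hM : ρ.sub G ≤ M) (h : ρ.sub (M.map (QuotientGroup.mk' (ρ.sub G))) = ⊥) :
    ρ.sub M = (ρ.sub G).subgroupOf M := by
  apply le_antisymm
  · have := hρ.map_le _ _ ((QuotientGroup.mk' (ρ.sub G)).subgroupMap M)
      (MonoidHom.subgroupMap_surjective _ _)
    rwa [h, le_bot_iff, Subgroup.map_eq_bot_iff, Subgroup.ker_subgroupMap,
      QuotientGroup.ker_mk'] at this
  · have h1 : ρ.sub (ρ.sub G) = ⊤ := by
      have := hρ.inf_normal G (ρ.sub G) inferInstance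
      rw [inf_idem] at this
      refine (Subgroup.eq_top_iff' _).2 fun x => ?_
      obtain ⟨y, hy, hyx⟩ := this.le x.2
      rwa [← show y = x from Subtype.ext hyx]
    have h2 : ρ.sub ((ρ.sub G).subgroupOf M) = ⊤ := by
      rw [← ρ.map_sub _ _ (Subgroup.subgroupOfEquivOfLe hM).symm, h1]
      exact Subgroup.map_top_of_surjective _ (MulEquiv.surjective _)
    have h3 := hρ.inf_normal M ((ρ.sub G).subgroupOf M) inferInstance
    rw [h2, ← MonoidHom.range_eq_map, Subgroup.range_subtype] at h3
    exact inf_eq_right.1 h3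

/-- A subgroup containing `(ρ ⋆ F*)(G)` has the same `(ρ ⋆ F*)`-subgroup as `G`. -/
theorem star_generalizedFitting_sub_eq_subgroupOf
    (hρ : ρ.IsHereditaryKuroshAmitsurRadical)
    (hsol : ∀ (G : Type u) [Group G] [Finite G], solubleRadical G ≤ ρ.sub G)
    {G : Type u} [Group G] [Finite G]
    {M : Subgroup G} (hM : (ρ.star generalizedFitting).sub G ≤ M) :
    (ρ.star generalizedFitting).sub M = ((ρ.star generalizedFitting).sub G).subgroupOf M := by
  set π := QuotientGroup.mk' (ρ.sub G) with hπ
  have hπs : Function.Surjective π := QuotientGroup.mk'_surjective _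
  have hS : (ρ.star generalizedFitting).sub G = (generalizedFitting.sub (G ⧸ ρ.sub G)).comap π :=
    rfl
  have hRM : ρ.sub G ≤ M := by
    refine le_trans (fun x hx => ?_) hM
    rw [hS, Subgroup.mem_comap, show π x = 1 from (QuotientGroup.eq_one_iff x).2 hx]
    exact one_mem _
  have hFM : generalizedFitting.sub (G ⧸ ρ.sub G) ≤ M.map π := by
    rw [← Subgroup.map_comap_eq_self_of_surjective hπs (generalizedFitting.sub _)]
    exact Subgroup.map_mono hM
  have h0 := hρ.sub_quotient G
  have hb := sub_eq_bot_of_generalizedFitting_le hρ hsol h0 hFM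
  have hker : (π.subgroupMap M).ker = ρ.sub M := by
    rw [Subgroup.ker_subgroupMap, QuotientGroup.ker_mk', sub_eq_subgroupOf hρ hRM hb]
  rw [star_sub_eq_comap _ _ _ (π.subgroupMap_surjective M) hker, hS,
    ← generalizedFitting_map_subtype_eq hρ hsol h0 hFM]
  ext x
  rw [Subgroup.mem_comap, Subgroup.mem_subgroupOf, Subgroup.mem_comap]
  exact (Subgroup.mem_map_iff_mem (f := (M.map π).subtype) (Subgroup.subtype_injective _)
    (x := π.subgroupMap M x)).symm

theorem isSolvable_of_isCoatom_bot {G : Type u} [Group G] (h : IsCoatom (⊥ : Subgroup G)) :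
    Group.IsSolvable G := by
  have : Nontrivial G := by
    by_contra hn
    rw [not_nontrivial_iff_subsingleton] at hn
    exact h.1 (Subsingleton.elim _ _)
  obtain ⟨g, hg⟩ := exists_ne (1 : G)
  have hz : Subgroup.zpowers g = ⊤ :=
    h.2 _ (bot_lt_iff_ne_bot.2 fun h0 => hg (Subgroup.zpowers_eq_bot.1 h0))
  refine Group.isSolvable_of_comm fun a b => ?_
  obtain ⟨i, rfl⟩ := Subgroup.mem_zpowers_iff.1 (hz ▸ Subgroup.mem_top a)
  obtain ⟨j, rfl⟩ := Subgroup.mem_zpowers_iff.1 (hz ▸ Subgroup.mem_top b)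
  rw [← zpow_add, ← zpow_add, add_comm]

theorem mk_comp_subtype_surjective {G : Type u} [Group G] {M N : Subgroup G} [N.Normal]
    (hM : IsCoatom M) (h : ¬ N ≤ M) :
    Function.Surjective ((QuotientGroup.mk' N).comp M.subtype) := by
  have hlt : M < M ⊔ N := lt_of_le_of_ne le_sup_left fun he => h (he ▸ le_sup_right)
  rw [← MonoidHom.range_eq_top, MonoidHom.range_comp, Subgroup.range_subtype]
  apply Subgroup.comap_injective (QuotientGroup.mk'_surjective N)
  rw [Subgroup.comap_map_eq, QuotientGroup.ker_mk', hM.2 _ hlt, Subgroup.comap_top]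

theorem isCoatom_map_of_ker_le {G H : Type u} [Group G] [Group H] {f : G →* H}
    (hf : Function.Surjective f) {M : Subgroup G} (hM : IsCoatom M) (hk : f.ker ≤ M) :
    IsCoatom (M.map f) := by
  have hcm : (M.map f).comap f = M := Subgroup.comap_map_eq_self hk
  refine ⟨fun h => hM.1 ?_, fun B hB => ?_⟩
  · rw [← hcm, h, Subgroup.comap_top]
  · have hlt : M < B.comap f := by
      rw [← hcm]
      exact (Subgroup.comap_lt_comap_of_surjective hf).2 hB
    rw [← Subgroup.map_comap_eq_self_of_surjective hf B, hM.2 _ hlt,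
      Subgroup.map_top_of_surjective _ hf]

theorem layers_succ_sub_eq_top (hρ : ρ.IsHereditaryKuroshAmitsurRadical)
    (hsol : ∀ (G : Type u) [Group G] [Finite G], solubleRadical G ≤ ρ.sub G)
    (n : ℕ) (G : Type u) [Group G] [Finite G] (M : Subgroup G)
    (hM : IsCoatom M) (h : (layers (ρ.star generalizedFitting) ρ n).sub M = ⊤) :
    (layers (ρ.star generalizedFitting) ρ (n + 1)).sub G = ⊤ := by
  have hρm : ρ.MapLE := fun G H _ _ _ _ f hf => hρ.map_le G H f hf
  have hLm := (hρm.star mapLE_generalizedFitting).layers hρm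
  set σ := ρ.star generalizedFitting with hσ
  induction n generalizing G with
  | zero =>
    rw [layers, star_sub_eq_top_iff _ _ (QuotientGroup.mk' (σ.sub G))
      (QuotientGroup.mk'_surjective _) (QuotientGroup.ker_mk' _)]
    by_cases hS : σ.sub G ≤ M
    · have hMS : σ.sub M = ⊤ := by
        rw [hσ, star_sub, eq_top_iff]
        intro x _
        have hx : QuotientGroup.mk' (ρ.sub M) x = 1 :=
          (QuotientGroup.eq_one_iff x).2 (h.symm ▸ Subgroup.mem_top x)
        rw [Subgroup.mem_comap, hx]
        exact one_mem _
      -- Now `M = σ(G)`, so `⊥` is maximal in `G / σ(G)`; that quotient is cyclic, hence soluble and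
      -- equal to its radical.
      rw [star_generalizedFitting_sub_eq_subgroupOf hρ hsol hS, Subgroup.subgroupOf_eq_top] at hMS
      have hc := isCoatom_map_of_ker_le (QuotientGroup.mk'_surjective (σ.sub G)) hM
        (by rwa [QuotientGroup.ker_mk'])
      rw [(Subgroup.map_eq_bot_iff _).2 (by rwa [QuotientGroup.ker_mk'])] at hc
      have := isSolvable_of_isCoatom_bot hc
      exact sub_eq_top_of_isSolvable hsol _
    · exact (hLm 0).sub_eq_top _ (mk_comp_subtype_surjective hM hS) h
  | succ n ih =>
    rw [layers, star_sub_eq_top_iff _ _ (QuotientGroup.mk' (σ.sub G))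
      (QuotientGroup.mk'_surjective _) (QuotientGroup.ker_mk' _)]
    by_cases hS : σ.sub G ≤ M
    · refine ih _ (M.map (QuotientGroup.mk' (σ.sub G)))
        (isCoatom_map_of_ker_le (QuotientGroup.mk'_surjective (σ.sub G)) hM
          (by rwa [QuotientGroup.ker_mk'])) ?_
      rwa [layers, star_sub_eq_top_iff _ _ _
        ((QuotientGroup.mk' (σ.sub G)).subgroupMap_surjective M)] at h
      rw [Subgroup.ker_subgroupMap, QuotientGroup.ker_mk']
      exact (star_generalizedFitting_sub_eq_subgroupOf hρ hsol hS).symm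
    · exact (hLm (n + 1)).sub_eq_top _ (mk_comp_subtype_surjective hM hS) h

end Layers

/-! ### From the series to the length. -/

section Length

variable {γ : Functorial.{u}} {G : Type u} [Group G] [Finite G]

theorem length_le_of_series_sub_eq_top {n : ℕ} (h : (γ.series n).sub G = ⊤) : γ.length G ≤ n :=
  sInf_le ⟨n, rfl, h⟩

theorem exists_length_eq (h : γ.length G < ⊤) :
    ∃ n : ℕ, γ.length G = n ∧ (γ.series n).sub G = ⊤ := by
  refine csInf_mem (s := {h : ℕ∞ | ∃ n : ℕ, h = n ∧ (γ.series n).sub G = ⊤}) ?_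
  by_contra hne
  rw [Set.not_nonempty_iff_eq_empty] at hne
  rw [length, hne, sInf_empty] at h
  exact lt_irrefl _ h

end Length

end Functorial

end RadicalLength

open RadicalLength RadicalLength.Functorial in
theorem mainTheorem3 (ρ : RadicalLength.Functorial.{u})
    (hρ : ρ.IsHereditaryKuroshAmitsurRadical)
    (hsol : ∀ (G : Type u) [Group G] [Finite G], RadicalLength.solubleRadical G ≤ ρ.sub G)
    (γ : RadicalLength.Functorial.{u})
    (hγ : γ = (ρ.star RadicalLength.Functorial.generalizedFitting).star ρ)
    (G : Type u) [Group G] [Finite G] (M : Subgroup G) (hM : IsCoatom M)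
    (hG_fin : γ.length G < ⊤) (hM_fin : γ.length M < ⊤) :
    ((γ.length G).toNat : ℤ) - ((γ.length M).toNat : ℤ) ≤ 1 := by
  have hσ : ρ.star (ρ.star generalizedFitting) = ρ.star generalizedFitting := by
    rw [← star_assoc, star_self hρ]
  obtain ⟨n, hn, hMn⟩ := exists_length_eq hM_fin
  have hL : (layers (ρ.star generalizedFitting) ρ n).sub M = ⊤ := by
    cases n with
    | zero =>
      -- The series starts at `1` but the layers start at `ρ`; at length `0` the group `M` is
      -- trivial, so the two still agree on it.
      have hbot : (⊥ : Subgroup M) = ⊤ := hMn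
      exact top_le_iff.1 (hbot.symm.le.trans bot_le)
    | succ n => rwa [hγ, series_succ_eq_layers hσ] at hMn
  have hG := layers_succ_sub_eq_top hρ hsol n G M hM hL
  rw [← series_succ_eq_layers hσ, ← hγ] at hG
  have hle := length_le_of_series_sub_eq_top hG
  obtain ⟨m, hm, -⟩ := exists_length_eq hG_fin
  rw [hm] at hle ⊢
  rw [hn, ENat.toNat_natCast, ENat.toNat_natCast]
  have hmn : m ≤ n + 1 := by exact_mod_cast hle
  omega
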